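/- Let $n\ge 2$, let $\emptyset\ne T\subseteq[n-1]$, and let $\Pi_n$ be the lattice of partitions of $[n]=\{1,\dots,n\}$ ordered by refinement. Let $\Pi_n(T)$ be the induced subposet of all $\pi\in\Pi_n$ such that the block of $\pi$ containing $n$ is either a singleton or has nonempty intersection with $T$. For $\omega\in S_n$ let $\Pi_\omega$ be the induced subposet of $\Pi_n$ consisting of all partitions $$\{\omega(1),\dots,\omega(i_1)\},\ \{\omega(i_1+1),\dots,\omega(i_2)\},\ \dots,\ \{\omega(i_k+1),\dots,\omega(n)\},\qquad \{i_1<\dots<i_k\}\subseteq[n-1],$$ obtained by splitting $\omega$. Write $\overline P$ for the proper part $P\setminus\{\hat 0,\hat 1\}$ of a bounded poset $P$, and $\widetilde H_*(\overline P)$ for the reduced integral simplicial homology of its order complex. For every $\omega\in S_n$ the group $\widetilde H_{n-3}(\overline{\Pi_\omega})$ is infinite cyclic; let $\rho_\omega$ be a fundamental cycle of $\overline{\Pi_\omega}$, that is, a generator of this group (unique up to sign). If $\omega(n)=n$ and $\omega(n-1)\in T$, then $\Pi_\omega\subseteq\Pi_n(T)$, and we regard $\rho_\omega$ as an element of $\widetilde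 H_{n-3}(\overline{\Pi_n(T)})$ via the inclusion. Then, for every choice of the signs of the $\rho_\omega$, the family $$\{\rho_\omega \mid \omega\in S_n,\ \omega(n)=n \text{ and } \omega(n-1)\in T\}$$ is a basis of the free abelian group $\widetilde H_{n-3}(\overline{\Pi_n(T)})$. -/

import Mathlib

/-! ### Reduced simplicial homology of the order complex of a poset

The order complex of `P` has the finite chains `x₁ < ⋯ < x_k` of `P` as its faces, the empty chain
included. Such a chain is an order embedding `Fin k ↪o P`; it is a face of dimension `k - 1`,
oriented by the order of its elements. All groups below are indexed by the number `k` of elements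
of a chain, that is, by dimension plus one, so that the reduced complex starts at `k = 0`. -/

namespace OrderComplex

variable (P : Type*) [PartialOrder P]

/-- The oriented chain group `C̃_{k-1}(Δ(P); ℤ)` of the order complex of `P`; in particular
`Chains P 0 ≅ ℤ` is spanned by the empty face. -/
abbrev Chains (k : ℕ) : Type _ := (Fin k ↪o P) →₀ ℤ

variable {P}

/-- The face of `c` obtained by deleting its `i`-th element. -/
def face {k : ℕ} (c : Fin (k + 1) ↪o P) (i : Fin (k + 1)) : Fin k ↪o P :=
  (Fin.succAboveOrderEmb i).trans c

variable (P)

/-- The boundary map `C̃_k → C̃_{k-1}`, sending `x₀ < ⋯ < x_k` to the sum over `i` of `(-1)^i` times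
the chain with `x_i` deleted. For `k = 0` this is the augmentation. -/
noncomputable def boundary (k : ℕ) : Chains P (k + 1) →ₗ[ℤ] Chains P k :=
  Finsupp.linearCombination ℤ fun c : Fin (k + 1) ↪o P =>
    ∑ i : Fin (k + 1), (-1 : ℤ) ^ (i : ℕ) • Finsupp.single (face c i) (1 : ℤ)

/-- The cycles in `C̃_{k-1}`; every element of `C̃_{-1}` is a cycle. -/
noncomputable def cycles : (k : ℕ) → Submodule ℤ (Chains P k)
  | 0 => ⊤
  | k + 1 => LinearMap.ker (boundary P k)

theorem boundary_boundary (k : ℕ) (z : Chains P (k + 2)) :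
    boundary P k (boundary P (k + 1) z) = 0 := by
  suffices h : (boundary P k).comp (boundary P (k + 1)) = 0 from LinearMap.congr_fun h z
  refine Finsupp.lhom_ext' fun c => LinearMap.ext_ring ?_
  simp only [boundary, LinearMap.comp_apply, Finsupp.lsingle_apply,
    Finsupp.linearCombination_single, one_smul, map_sum, map_smul, LinearMap.zero_apply,
    Finset.smul_sum]
  rw [← Fintype.sum_prod_type']
  refine Finset.sum_involution (fun p _ => (p.1.succAbove p.2, p.2.predAbove p.1)) ?_ ?_ ?_ ?_
  · rintro ⟨i, j⟩ -
    have hf : face (face c (i.succAbove j)) (j.predAbove i) = face (face c i) j := by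
      ext x
      simp [face, Fin.succAbove_succAbove_succAbove_predAbove]
    simp only [hf, smul_smul, ← pow_add, Fin.neg_one_pow_succAbove_add_predAbove, neg_smul,
      add_neg_cancel]
  · rintro ⟨i, j⟩ - - h
    exact Fin.succAbove_ne i j (congrArg Prod.fst h)
  · intro _ _
    exact Finset.mem_univ _
  · rintro ⟨i, j⟩ -
    simp [Fin.succAbove_succAbove_predAbove, Fin.predAbove_predAbove_succAbove]

theorem boundary_mem_cycles (k : ℕ) (z : Chains P (k + 1)) : boundary P k z ∈ cycles P k := by
  cases k with
  | zero => exact Submodule.mem_top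
  | succ k => exact boundary_boundary P k z

/-- The boundaries in `C̃_{k-1}`, as a subgroup of the cycles. -/
noncomputable def boundaries (k : ℕ) : Submodule ℤ (cycles P k) :=
  LinearMap.range ((boundary P k).codRestrict (cycles P k) (boundary_mem_cycles P k))

/-- The reduced homology group `H̃_{k-1}(P; ℤ)` of the order complex of `P`: chains with `k`
elements, so that `H̃_d(P)` is `ReducedHomology P (d + 1)`. -/
abbrev ReducedHomology (k : ℕ) : Type _ := cycles P k ⧸ boundaries P k

variable {P}
variable {Q : Type*} [PartialOrder Q]

/-- The map of chain groups induced by an order embedding of posets. -/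
noncomputable def mapChains (f : P ↪o Q) (k : ℕ) : Chains P k →ₗ[ℤ] Chains Q k :=
  Finsupp.lmapDomain ℤ ℤ fun c : Fin k ↪o P => c.trans f

theorem boundary_mapChains (f : P ↪o Q) (k : ℕ) (z : Chains P (k + 1)) :
    boundary Q k (mapChains f (k + 1) z) = mapChains f k (boundary P k z) := by
  suffices h : (boundary Q k).comp (mapChains f (k + 1)) = (mapChains f k).comp (boundary P k) from
    LinearMap.congr_fun h z
  refine Finsupp.lhom_ext' fun c => LinearMap.ext_ring ?_
  simp only [boundary, mapChains, LinearMap.comp_apply, Finsupp.lsingle_apply,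
    Finsupp.lmapDomain_apply, Finsupp.mapDomain_single, Finsupp.linearCombination_single, one_smul,
    map_sum, map_smul]
  rfl

theorem mapChains_mem_cycles (f : P ↪o Q) (k : ℕ) (z : Chains P k) (hz : z ∈ cycles P k) :
    mapChains f k z ∈ cycles Q k := by
  cases k with
  | zero => exact Submodule.mem_top
  | succ k =>
    have hz' : boundary P k z = 0 := hz
    change boundary Q k (mapChains f (k + 1) z) = 0
    rw [boundary_mapChains, hz', map_zero]

/-- The map of cycle groups induced by an order embedding of posets. -/
noncomputable def mapCycles (f : P ↪o Q) (k : ℕ) : cycles P k →ₗ[ℤ] cycles Q k :=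
  (mapChains f k).restrict (mapChains_mem_cycles f k)

theorem boundaries_le_comap (f : P ↪o Q) (k : ℕ) :
    boundaries P k ≤ (boundaries Q k).comap (mapCycles f k) := by
  rintro _ ⟨w, rfl⟩
  exact ⟨mapChains f (k + 1) w, Subtype.ext (boundary_mapChains f k w)⟩

/-- The map in reduced homology induced by an order embedding of posets. -/
noncomputable def mapHomology (f : P ↪o Q) (k : ℕ) :
    ReducedHomology P k →ₗ[ℤ] ReducedHomology Q k :=
  (boundaries P k).mapQ (boundaries Q k) (mapCycles f k) (boundaries_le_comap f k)

/-- `z` is a fundamental cycle of a spherical poset of dimension `k - 1`: the group `H̃_{k-1}(P)` is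
infinite cyclic, and `z` is a generator of it. (So `z` is unique up to sign.) -/
def IsFundamentalCycle {k : ℕ} (z : ReducedHomology P k) : Prop :=
  ∃ e : ReducedHomology P k ≃ₗ[ℤ] ℤ, e z = 1

end OrderComplex

/-! ### Proper parts -/

/-- The proper part of a bounded poset: the least and the greatest element are removed. -/
abbrev ProperPart (P : Type*) [PartialOrder P] : Type _ := {x : P // ¬ IsBot x ∧ ¬ IsTop x}

/-- The inclusion of proper parts induced by an inclusion of induced subposets. -/
def ProperPart.inclusion {L : Type*} [PartialOrder L] {A B : Set L} (h : A ⊆ B) :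
    ProperPart A ↪o ProperPart B where
  toFun x := ⟨⟨x.1.1, h x.1.2⟩,
    fun hb => x.2.1 fun y => hb ⟨y, h y.2⟩, fun ht => x.2.2 fun y => ht ⟨y, h y.2⟩⟩
  inj' _ _ hxy := Subtype.ext (Subtype.ext (congrArg (fun z => z.1.1) hxy))
  map_rel_iff' := Iff.rfl

/-! ### Partitions

The set `[n] = {1, …, n}` is modelled by `Fin n`, the number `m` being `⟨m - 1, _⟩`. The partition
lattice `Π_n` is the lattice `Setoid (Fin n)` of equivalence relations, `π x y` saying that `x` and
`y` are in the same block of `π`; it is ordered by refinement. -/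

namespace PartitionLattice

variable {n : ℕ}

/-- The partition obtained by splitting the word `ω(1), …, ω(n)` at the positions in `S`: the
elements `x` and `y` are in the same block iff no `i ∈ S` has one of them among `ω(1), …, ω(i)` and
the other one among `ω(i+1), …, ω(n)`. The position of `x` in the word is `ω⁻¹ x + 1` as a
number. -/
def split (ω : Equiv.Perm (Fin n)) (S : Finset ℕ) : Setoid (Fin n) where
  r x y := ∀ i ∈ S, ((ω⁻¹ x : Fin n) : ℕ) + 1 ≤ i ↔ ((ω⁻¹ y : Fin n) : ℕ) + 1 ≤ i
  iseqv :=
    { refl := fun _ _ _ => Iff.rfl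
      symm := fun h i hi => (h i hi).symm
      trans := fun h h' i hi => (h i hi).trans (h' i hi) }

/-- The subposet `Π_ω` of `Π_n`: all partitions obtained by splitting `ω` at a set of positions in
`[n-1]`. -/
def splittings (ω : Equiv.Perm (Fin n)) : Set (Setoid (Fin n)) :=
  {π | ∃ S ⊆ Finset.Icc 1 (n - 1), split ω S = π}

/-- The subposet `Π_n(T)` of `Π_n`: all partitions in which the block of `n` is a singleton or
meets `T`. -/
def restricted (hn : 2 ≤ n) (T : Set (Fin n)) : Set (Setoid (Fin n)) :=
  {π | (∀ x, π ⟨n - 1, by omega⟩ x → x = ⟨n - 1, by omega⟩) ∨ ∃ t ∈ T, π ⟨n - 1, by omega⟩ t}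

/-- The permutations `ω` of `[n]` with `ω(n) = n` and `ω(n-1) ∈ T`. -/
def basisPerms (hn : 2 ≤ n) (T : Set (Fin n)) : Set (Equiv.Perm (Fin n)) :=
  {ω | ω ⟨n - 1, by omega⟩ = ⟨n - 1, by omega⟩ ∧ ω ⟨n - 2, by omega⟩ ∈ T}

theorem splittings_subset_restricted (hn : 2 ≤ n) (T : Set (Fin n)) (ω : Equiv.Perm (Fin n))
    (hω : ω ∈ basisPerms hn T) : splittings ω ⊆ restricted hn T := by
  rintro _ ⟨S, hS, rfl⟩
  obtain ⟨h1, h2⟩ := hω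
  have h3 : ω⁻¹ (⟨n - 1, by omega⟩ : Fin n) = ⟨n - 1, by omega⟩ := by
    rw [Equiv.Perm.inv_eq_iff_eq, h1]
  have h4 : ω⁻¹ (ω ⟨n - 2, by omega⟩) = (⟨n - 2, by omega⟩ : Fin n) :=
    Equiv.symm_apply_apply ω _
  by_cases hc : n - 1 ∈ S
  · left
    intro x hx
    have := hx (n - 1) hc
    rw [h3] at this
    have hx' : ω⁻¹ x = ⟨n - 1, by omega⟩ := by
      apply Fin.ext
      have := (ω⁻¹ x).2
      simp only at *
      omega
    rw [Equiv.Perm.inv_eq_iff_eq] at hx'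
    rw [hx', h1]
  · right
    refine ⟨_, h2, fun i hi => ?_⟩
    rw [h3, h4]
    have hi' := Finset.mem_Icc.1 (hS hi)
    have : i ≠ n - 1 := fun h => hc (h ▸ hi)
    simp only
    omega

end PartitionLattice

/-!
The homology in question is top-dimensional: passing to a strictly coarser partition loses a block
(`card_quotient_lt`), so a chain of proper partitions has at most `n - 2` elements, there are no
boundaries, and `H̃_{n-3}` is the group of cycles, for every induced subposet of `Π_n`. The proof
exhibits maximal chains, the spines, that are dual to the cycles `ρ_ω`.

Follow the block of a fixed point `p` along a maximal chain `c`. If it does not grow in every step,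
then it stays the same in some step and grows in the next one. Replacing the partition between
these two steps by any other one makes the block of `p` there strictly larger
(`block_ssubset_of_ne`). Hence, if a nonzero cycle had no chain in its support along which the block
of `p` grows in every step, a chain of its support with the largest sum of block sizes would have a
face contained in no other chain of the support, and the boundary would not vanish there
(`eq_zero_of_boundary_eq_zero`). So a cycle is determined by its coefficients at the chains along
which the block of `p` always grows (`cycle_eq_zero_of_growing`). Such a chain adds single points to
the block of `p` and keeps all other points as singletons, that is, it is the spine of a permutation
`ω` with last letter `p`: its partitions are obtained by cutting `ω` at the positions `1, …, i`
(`exists_perm_of_growing`).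

The only permutation with last letter `p` whose spine lies in `Π_τ`, where `τ` has last letter `p`
as well, is `τ` (`eq_of_spine_mem_splittings`). So the coefficient at the spine of `τ` is injective
on the cycles of `Π_τ`, and it is onto `ℤ` because the order complex is the barycentric subdivision
of the boundary of a simplex, with a cycle all of whose coefficients are `±1` (`sphereCycle`). It
follows that `ρ_τ` has coefficient `±1` at the spine of `τ` and `0` at all other spines. In `Π_n(T)`,
with `p = n`, the spines are exactly those of the permutations with `ω(n) = n` and `ω(n-1) ∈ T`
(`mem_basisPerms`), so the coefficients at the spines identify `H̃_{n-3}` with a free group in which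
the `ρ_ω` are the standard basis up to signs (`exists_basis`).
-/

/-! ### Cycles in the top dimension -/

namespace OrderComplex

section TopCycles

variable {P : Type*} [PartialOrder P] {k : ℕ}

theorem face_injective (c : Fin (k + 1) ↪o P) : Function.Injective (face c) := by
  intro i j h
  refine Fin.succAbove_left_injective (funext fun x => c.injective ?_)
  exact DFunLike.congr_fun h x

open Classical in
theorem boundary_apply (z : Chains P (k + 1)) (r : Fin k ↪o P) :
    boundary P k z r =
      z.sum fun c a => a * ∑ i : Fin (k + 1), (-1) ^ (i : ℕ) * if face c i = r then 1 else 0 := by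
  simp [boundary, Finsupp.linearCombination_apply, Finsupp.sum, Finsupp.finsetSum_apply,
    Finsupp.single_apply]

/-- A cycle `z` vanishes if every chain `c` of its support has a face that is contained, apart from
`c`, only in chains on which `μ` is larger: at a chain of the support that maximizes `μ`, the
coefficient of `∂z` at that face would be `± z c`. -/
theorem eq_zero_of_boundary_eq_zero {z : Chains P (k + 1)} (hz : boundary P k z = 0)
    (μ : (Fin (k + 1) ↪o P) → ℕ)
    (h : ∀ c, z c ≠ 0 → ∃ i, ∀ c' i', face c' i' = face c i → c' ≠ c → μ c < μ c') : z = 0 := by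
  classical
  by_contra hne
  obtain ⟨c, hc, hmax⟩ := z.support.exists_max_image μ (Finsupp.support_nonempty_iff.2 hne)
  obtain ⟨i, hi⟩ := h c (Finsupp.mem_support_iff.1 hc)
  have h0 := boundary_apply z (face c i)
  rw [hz, Finsupp.sum, Finset.sum_eq_single_of_mem c hc, Finset.sum_eq_single i] at h0
  · simp at h0
    exact Finsupp.mem_support_iff.1 hc h0
  · intro j _ hj
    simp [(face_injective c).eq_iff, hj]
  · simp
  · intro c' hc' hne'
    have : ∀ i', face c' i' ≠ face c i := fun i' hi' =>
      absurd (hi c' i' hi' hne') (hmax c' hc').not_gt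
    simp [this]

variable (P k) in
theorem boundaries_eq_bot [IsEmpty (Fin (k + 1) ↪o P)] : boundaries P k = ⊥ := by
  rw [boundaries, LinearMap.range_eq_bot]
  exact Subsingleton.elim _ _

variable (P k) in
/-- If `P` has no chains with `k + 1` elements, then its homology in degree `k` is the group of
cycles. -/
noncomputable def homologyEquivCycles [IsEmpty (Fin (k + 1) ↪o P)] :
    ReducedHomology P k ≃ₗ[ℤ] cycles P k :=
  Submodule.quotEquivOfEqBot _ (boundaries_eq_bot P k)

variable {Q : Type*} [PartialOrder Q]

theorem homologyEquivCycles_mapHomology [IsEmpty (Fin (k + 1) ↪o P)] [IsEmpty (Fin (k + 1) ↪o Q)]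
    (f : P ↪o Q) (x : ReducedHomology P k) :
    homologyEquivCycles Q k (mapHomology f k x) = mapCycles f k (homologyEquivCycles P k x) := by
  obtain ⟨z, rfl⟩ := Submodule.Quotient.mk_surjective _ x
  rfl

theorem trans_left_injective (f : P ↪o Q) :
    Function.Injective fun c : Fin k ↪o P => c.trans f := by
  intro c d h
  ext i
  exact f.injective (DFunLike.congr_fun h i)

theorem mapChains_apply_trans (f : P ↪o Q) (z : Chains P k) (c : Fin k ↪o P) :
    mapChains f k z (c.trans f) = z c :=
  Finsupp.mapDomain_apply (trans_left_injective f) z c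

theorem exists_eq_trans_of_mapChains_ne_zero (f : P ↪o Q) (z : Chains P k) (d : Fin k ↪o Q)
    (h : mapChains f k z d ≠ 0) : ∃ c : Fin k ↪o P, c.trans f = d := by
  by_contra hd
  exact h (Finsupp.mapDomain_of_notMem_range z d fun ⟨c, hc⟩ => hd ⟨c, hc⟩)

end TopCycles

end OrderComplex

namespace PartitionLattice

open OrderComplex

/-! ### Maximal chains of partitions -/

/-- A strictly coarser partition has fewer blocks. -/
theorem card_quotient_lt {α : Type*} [Finite α] {x y : Setoid α} (h : x < y) :
    Nat.card (Quotient y) < Nat.card (Quotient x) := by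
  have hsurj : Function.Surjective (Quotient.map' (s₁ := x) (s₂ := y) id fun _ _ hab => h.le hab) :=
    fun q => q.inductionOn' fun a => ⟨Quotient.mk'' a, rfl⟩
  refine (Nat.card_le_card_of_surjective _ hsurj).lt_of_ne fun he => h.not_ge fun a b hab => ?_
  have hinj := ((Nat.bijective_iff_surjective_and_card _).2 ⟨hsurj, he.symm⟩).1
  exact Quotient.exact' (hinj (Quotient.sound' hab : (Quotient.mk'' a : Quotient y) = _))

variable {n k : ℕ} {A : Set (Setoid (Fin n))}

/-- The chain `c` of the proper part of `A` with the least and the greatest partition added at its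
ends: `⊥ < c 0 < ⋯ < c (k - 1) < ⊤`, indexed by `0, …, k + 1` and constant from there on. -/
def extend (c : Fin k ↪o ProperPart A) : ℕ → Setoid (Fin n)
  | 0 => ⊥
  | i + 1 => if h : i < k then (c ⟨i, h⟩).1.1 else ⊤

@[simp] theorem extend_zero (c : Fin k ↪o ProperPart A) : extend c 0 = ⊥ := rfl

@[simp] theorem extend_fin_succ (c : Fin k ↪o ProperPart A) (i : Fin k) :
    extend c (i + 1) = (c i).1.1 := by
  simp [extend]

@[simp] theorem extend_top (c : Fin k ↪o ProperPart A) : extend c (k + 1) = ⊤ := by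
  simp [extend]

theorem extend_congr {c d : Fin k ↪o ProperPart A} {i : Fin k} (h : ∀ j ≠ i, d j = c j) {m : ℕ}
    (hm : m ≠ i + 1) : extend d m = extend c m := by
  cases m with
  | zero => rfl
  | succ m =>
    simp only [extend]
    split_ifs with hk
    · rw [h]
      rintro rfl
      exact hm rfl
    · rfl

theorem extend_mem (hbot : ⊥ ∈ A) (htop : ⊤ ∈ A) (c : Fin k ↪o ProperPart A) (m : ℕ) :
    extend c m ∈ A := by
  cases m with
  | zero => exact hbot
  | succ m =>
    simp only [extend]
    split_ifs
    · exact (c _).1.2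
    · exact htop

theorem extend_lt_extend_succ (hn : 2 ≤ n)
    (c : Fin k ↪o ProperPart A) {i : ℕ} (hi : i ≤ k) : extend c i < extend c (i + 1) := by
  have h1 : ∀ x : ProperPart A, ⊥ < x.1.1 := fun x =>
    bot_lt_iff_ne_bot.2 fun h => x.2.1 fun y => show x.1.1 ≤ y.1 from h ▸ bot_le
  have h2 : ∀ x : ProperPart A, x.1.1 < ⊤ := fun x =>
    lt_top_iff_ne_top.2 fun h => x.2.2 fun y => show y.1 ≤ x.1.1 from h ▸ le_top
  rcases hi.eq_or_lt with rfl | hi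
  · rw [extend_top]
    cases i with
    | zero =>
      refine bot_lt_iff_ne_bot.2 fun h => ?_
      have h01 : (⊥ : Setoid (Fin n)) ⟨0, by omega⟩ ⟨1, by omega⟩ := h ▸ trivial
      exact absurd (congrArg Fin.val (show (⟨0, _⟩ : Fin n) = ⟨1, _⟩ from h01)) zero_ne_one
    | succ i => exact (extend_fin_succ c ⟨i, by omega⟩).trans_lt (h2 _)
  · rw [extend_fin_succ c ⟨i, hi⟩]
    cases i with
    | zero => exact h1 _
    | succ i =>
      rw [extend_fin_succ c ⟨i, by omega⟩]
      exact c.strictMono (Fin.mk_lt_mk.2 (Nat.lt_succ_self i))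

theorem card_quotient_extend_add_le (hn : 2 ≤ n)
    (c : Fin k ↪o ProperPart A) {i : ℕ} (hi : i ≤ k + 1) :
    Nat.card (Quotient (extend c i)) + i ≤ n := by
  induction i with
  | zero =>
    simpa using Nat.card_le_card_of_surjective (Quotient.mk'' : Fin n → Quotient (extend c 0))
      Quotient.mk''_surjective
  | succ i ih =>
    have := card_quotient_lt (extend_lt_extend_succ hn c (i := i) (by omega))
    have := ih (by omega)
    omega

theorem le_card_quotient_extend_add (hn : 2 ≤ n)
    (c : Fin k ↪o ProperPart A) {i : ℕ} (hi : i ≤ k + 1) :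
    k + 2 ≤ Nat.card (Quotient (extend c i)) + i := by
  induction hi using Nat.decreasingInduction with
  | self =>
    have : Nonempty (Quotient (extend c (k + 1))) := ⟨Quotient.mk'' ⟨0, by omega⟩⟩
    have := Nat.card_pos (α := Quotient (extend c (k + 1)))
    omega
  | of_succ i hi ih =>
    have := card_quotient_lt (extend_lt_extend_succ hn c (i := i) (by omega))
    omega

theorem isEmpty_chains (hk : k + 2 = n) :
    IsEmpty (Fin (k + 1) ↪o ProperPart A) := by
  refine ⟨fun c => ?_⟩
  have h1 := card_quotient_extend_add_le (by omega) c le_rfl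
  have h2 := le_card_quotient_extend_add (by omega) c le_rfl
  omega

/-- A chain with `n - 2` elements loses exactly one block in every step. -/
theorem card_quotient_extend (hk : k + 2 = n)
    (c : Fin k ↪o ProperPart A) {i : ℕ} (hi : i ≤ k + 1) :
    Nat.card (Quotient (extend c i)) + i = n :=
  (card_quotient_extend_add_le (by omega) c hi).antisymm
    (hk ▸ le_card_quotient_extend_add (by omega) c hi)

theorem extend_covBy (hk : k + 2 = n)
    (c : Fin k ↪o ProperPart A) {i : ℕ} (hi : i ≤ k) : extend c i ⋖ extend c (i + 1) := by
  refine ⟨extend_lt_extend_succ (by omega) c hi, fun y h1 h2 => ?_⟩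
  have := card_quotient_lt h1
  have := card_quotient_lt h2
  have := card_quotient_extend hk c (i := i) (by omega)
  have := card_quotient_extend hk c (i := i + 1) (by omega)
  omega

/-! ### Growth of the block of a point along a chain -/

/-- The block of `p` in the partition `x`. -/
def block (p : Fin n) (x : Setoid (Fin n)) : Set (Fin n) := {a | x p a}

theorem block_mono (p : Fin n) : Monotone (block p) := fun _ _ h _ ha => h ha

theorem block_sup {p : Fin n} {x y : Setoid (Fin n)} (h : block p x = block p y) :
    block p (x ⊔ y) = block p x := by
  refine (block_mono p le_sup_left).antisymm' fun a ha => ?_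
  -- Both partitions refine the partition into the block of `p` and its complement.
  let w : Setoid (Fin n) := Setoid.ker fun a => a ∈ block p x
  have hx : ∀ v : Setoid (Fin n), block p v = block p x → v ≤ w := fun v hv a b hab => by
    refine propext ?_
    rw [← hv]
    exact ⟨fun h => v.trans h hab, fun h => v.trans h (v.symm hab)⟩
  have h1 : w p a := sup_le (hx x rfl) (hx y h.symm) ha
  exact (congrArg id (show (p ∈ block p x) = (a ∈ block p x) from h1)).mp (x.refl p)

/-- If the block of `p` does not grow in every step, then it is constant in some step and grows in
the next one, because it is everything at the end and not before. -/
theorem exists_block_eq_block_ne (hk : k + 2 = n) (p : Fin n)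
    (c : Fin k ↪o ProperPart A)
    (h : ∃ i ≤ k, block p (extend c i) = block p (extend c (i + 1))) :
    ∃ i : Fin k, block p (extend c i) = block p (extend c (i + 1)) ∧
      block p (extend c (i + 1)) ≠ block p (extend c (i + 2)) := by
  by_contra! hno
  obtain ⟨i, hi, heq⟩ := h
  have hprop : ∀ j, i ≤ j → j ≤ k → block p (extend c j) = block p (extend c (j + 1)) := by
    intro j hij
    induction j, hij using Nat.le_induction with
    | base => exact fun _ => heq
    | succ j _ ih => exact fun hj => hno ⟨j, hj⟩ (ih (by omega))
  have hlast := hprop k hi le_rfl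
  rw [extend_top] at hlast
  refine (extend_top c ▸ extend_lt_extend_succ (by omega) c le_rfl).ne
    (Setoid.ext fun a b => ⟨fun _ => trivial, fun _ => ?_⟩)
  have hall : ∀ a, extend c k p a := fun a => by
    have : a ∈ block p (extend c k) := hlast ▸ trivial
    exact this
  exact (extend c k).trans ((extend c k).symm (hall a)) (hall b)

/-- If the block of `p` is constant in the step to `c i` and grows in the next one, then any other
element in place of `c i` has a larger block of `p`: the join of two candidates with the same block
`B` of `p` has the block `B` again, so it cannot be the next element of the chain. -/
theorem block_ssubset_of_ne (hk : k + 2 = n) (p : Fin n)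
    {c d : Fin k ↪o ProperPart A} {i : Fin k} (hcd : ∀ j ≠ i, d j = c j) (hne : d ≠ c)
    (h1 : block p (extend c i) = block p (extend c (i + 1)))
    (h2 : block p (extend c (i + 1)) ≠ block p (extend c (i + 2))) :
    block p (c i).1.1 ⊂ block p (d i).1.1 := by
  have hi := i.2
  have e0 : extend d i = extend c i := extend_congr hcd (by omega)
  have e2 : extend d (i + 2) = extend c (i + 2) := extend_congr hcd (by omega)
  have c1 := extend_covBy hk c (i := i) (by omega)
  have c2 := extend_covBy hk c (i := i + 1) (by omega)
  have d1 := extend_covBy hk d (i := i) (by omega)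
  have d2 := extend_covBy hk d (i := i + 1) (by omega)
  rw [e0] at d1
  rw [e2] at d2
  rw [← extend_fin_succ c, ← extend_fin_succ d, ← h1]
  refine (block_mono p d1.le).ssubset_of_ne fun heq => ?_
  have hb := block_sup (h1.symm.trans heq)
  -- The join of the two candidates is squeezed into the cover `extend c (i+1) ⋖ extend c (i+2)`.
  rcases c2.eq_or_eq (c := extend c (i + 1) ⊔ extend d (i + 1)) le_sup_left
    (sup_le c2.le d2.le) with h | h
  · rcases c1.eq_or_eq d1.le (sup_eq_left.1 h) with h' | h'
    · exact d1.lt.ne h'.symm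
    · refine hne (RelEmbedding.ext fun j => ?_)
      by_cases hj : j = i
      · subst hj
        rw [extend_fin_succ, extend_fin_succ] at h'
        exact Subtype.ext (Subtype.ext h')
      · exact hcd j hj
  · exact h2 (hb ▸ h ▸ rfl)

/-- Two maximal chains with a common face differ at most in the place of the deleted element, since
the number of blocks determines the place of a partition in a maximal chain. -/
theorem apply_eq_of_face_eq (hk : k + 3 = n)
    {c d : Fin (k + 1) ↪o ProperPart A} {i i' : Fin (k + 1)} (h : face d i' = face c i) :
    ∀ j ≠ i, d j = c j := by
  have hd : ∀ x, d (i'.succAbove x) = c (i.succAbove x) := DFunLike.congr_fun h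
  have hii : i' = i := by
    refine Fin.succAbove_left_injective (funext fun x => Fin.ext ?_)
    have h1 := card_quotient_extend (by omega) d (i := i'.succAbove x + 1) (by omega)
    have h2 := card_quotient_extend (by omega) c (i := i.succAbove x + 1) (by omega)
    rw [extend_fin_succ] at h1 h2
    rw [hd] at h1
    omega
  subst hii
  intro j hj
  obtain ⟨x, rfl⟩ := Fin.exists_succAbove_eq hj
  exact hd x

/-- A top-dimensional cycle is determined by its coefficients at the chains along which the block of
`p` grows in every step. -/
theorem cycle_eq_zero_of_growing (hk : k + 2 = n) (p : Fin n)
    {z : Chains (ProperPart A) k} (hz : z ∈ cycles (ProperPart A) k)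
    (h : ∀ c : Fin k ↪o ProperPart A,
      (∀ i ≤ k, block p (extend c i) ⊂ block p (extend c (i + 1))) → z c = 0) : z = 0 := by
  have key : ∀ c, z c ≠ 0 → ∃ i : Fin k, block p (extend c i) = block p (extend c (i + 1)) ∧
      block p (extend c (i + 1)) ≠ block p (extend c (i + 2)) := by
    intro c hc
    refine exists_block_eq_block_ne hk p c ?_
    by_contra! hno
    exact hc (h c fun i hi => (block_mono p
      (extend_lt_extend_succ (by omega) c hi).le).ssubset_of_ne (hno i hi))
  cases k with
  | zero =>
    ext c
    by_contra hc
    exact (key c hc).elim fun i => i.elim0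
  | succ k =>
    refine eq_zero_of_boundary_eq_zero hz (fun c => ∑ j, (block p (c j).1.1).ncard) fun c hc => ?_
    obtain ⟨i, h1, h2⟩ := key c hc
    refine ⟨i, fun d i' hface hne => ?_⟩
    have hcd := apply_eq_of_face_eq (by omega) hface
    have hlt := Set.ncard_lt_ncard (block_ssubset_of_ne hk p hcd hne h1 h2)
    refine Finset.sum_lt_sum (fun j _ => ?_) ⟨i, Finset.mem_univ _, hlt⟩
    by_cases hj : j = i
    · exact hj ▸ hlt.le
    · rw [hcd j hj]

/-! ### Chains with a single growing block -/

/-- If the block of `p` grows in every step of a saturated chain, then it is the only nontrivial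
block of each partition in the chain. -/
theorem eq_iff_of_growing {x : ℕ → Setoid (Fin n)} {p : Fin n} {m : ℕ} (h0 : x 0 = ⊥)
    (hcov : ∀ i < m, x i ⋖ x (i + 1)) (hgrow : ∀ i < m, block p (x i) ⊂ block p (x (i + 1)))
    {i : ℕ} (hi : i ≤ m) (a b : Fin n) : x i a b ↔ a = b ∨ a ∈ block p (x i) ∧ b ∈ block p (x i) := by
  induction i generalizing a b with
  | zero =>
    have hp : ∀ c, c ∈ block p (x 0) ↔ p = c := fun c => by rw [h0]; rfl
    rw [hp, hp, h0]
    change a = b ↔ _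
    exact ⟨Or.inl, fun h => h.elim id fun h => h.1.symm.trans h.2⟩
  | succ i ih =>
    -- The partition whose only nontrivial block is the block of `p` in `x (i + 1)`.
    let y : Setoid (Fin n) :=
      { r a b := a = b ∨ a ∈ block p (x (i + 1)) ∧ b ∈ block p (x (i + 1))
        iseqv := ⟨fun _ => Or.inl rfl, by grind, by grind⟩ }
    have hy1 : x i ≤ y := fun a b hab => by
      rcases (ih (by omega) a b).1 hab with h | h
      · exact Or.inl h
      · exact Or.inr ⟨(hgrow i (by omega)).1 h.1, (hgrow i (by omega)).1 h.2⟩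
    have hy2 : y ≤ x (i + 1) := fun a b hab => by
      rcases hab with rfl | ⟨h1, h2⟩
      · exact (x (i + 1)).refl a
      · exact (x (i + 1)).trans ((x (i + 1)).symm h1) h2
    have hp : p ∈ block p (x (i + 1)) := (x (i + 1)).refl p
    rcases (hcov i (by omega)).eq_or_eq hy1 hy2 with h | h
    · exact absurd (fun a ha => h ▸ (Or.inr ⟨hp, ha⟩ : y p a)) (hgrow i (by omega)).2
    · have : x (i + 1) a b ↔ y a b := by rw [h]
      exact this

/-- Cutting `ω` at all positions up to `n - 1 - i` leaves the last `i + 1` letters as one block and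
makes all other blocks singletons. -/
theorem split_Icc_iff (ω : Equiv.Perm (Fin n)) {i : ℕ} (a b : Fin n) :
    split ω (Finset.Icc 1 (n - 1 - i)) a b ↔
      a = b ∨ n ≤ (ω⁻¹ a : Fin n) + 1 + i ∧ n ≤ (ω⁻¹ b : Fin n) + 1 + i := by
  change (∀ s ∈ Finset.Icc 1 (n - 1 - i), ((ω⁻¹ a : Fin n) : ℕ) + 1 ≤ s ↔
    ((ω⁻¹ b : Fin n) : ℕ) + 1 ≤ s) ↔ _
  have hab : a = b ↔ ((ω⁻¹ a : Fin n) : ℕ) = (ω⁻¹ b : Fin n) := by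
    rw [← Fin.ext_iff, ω⁻¹.injective.eq_iff]
  have ha := (ω⁻¹ a).2
  have hb := (ω⁻¹ b).2
  rw [hab]
  generalize ((ω⁻¹ a : Fin n) : ℕ) = u at *
  generalize ((ω⁻¹ b : Fin n) : ℕ) = v at *
  simp only [Finset.mem_Icc]
  constructor
  · intro h
    have h1 := h (u + 1)
    have h2 := h (v + 1)
    omega
  · intro h s hs
    omega

/-- The saturated chains along which the block of `p` grows in every step come from the permutations
`ω` with last letter `p`: the block takes in `ω(n-1)`, `ω(n-2)`, … one after the other. -/
theorem exists_perm_of_growing (hn : 2 ≤ n) {x : ℕ → Setoid (Fin n)} {p : Fin n} (h0 : x 0 = ⊥)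
    (hcov : ∀ i < n - 1, x i ⋖ x (i + 1))
    (hgrow : ∀ i < n - 1, block p (x i) ⊂ block p (x (i + 1))) :
    ∃ ω : Equiv.Perm (Fin n), ω ⟨n - 1, by omega⟩ = p ∧
      ∀ i ≤ n - 1, x i = split ω (Finset.Icc 1 (n - 1 - i)) := by
  have hmono : ∀ i j, i ≤ j → j ≤ n - 1 → block p (x i) ⊆ block p (x j) := by
    intro i j hij
    induction j, hij using Nat.le_induction with
    | base => exact fun _ => subset_rfl
    | succ j _ ih => exact fun hj => (ih (by omega)).trans (hgrow j (by omega)).1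
  -- `f i` is the element that joins the block of `p` in step `i`, and `f 0 = p`.
  have hex : ∀ i : Fin n, ∃ a, a ∈ block p (x i) ∧ ∀ j < (i : ℕ), a ∉ block p (x j) := by
    rintro ⟨i, hi⟩
    cases i with
    | zero => exact ⟨p, (x 0).refl p, by simp⟩
    | succ i =>
      obtain ⟨a, ha, hna⟩ := Set.exists_of_ssubset (hgrow i (by omega))
      exact ⟨a, ha, fun j hj hja => hna (hmono j i (by simp at hj; omega) (by omega) hja)⟩
  choose f hf hfn using hex
  have hinj : Function.Injective f := by
    intro i j hij
    rcases lt_trichotomy i j with h | h | h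
    · exact absurd (hij ▸ hf i) (hfn j i h)
    · exact h
    · exact absurd (hij ▸ hf j) (hfn i j h)
  let e : Equiv.Perm (Fin n) := Equiv.ofBijective f (Finite.injective_iff_bijective.1 hinj)
  have hblock : ∀ i ≤ n - 1, ∀ a, a ∈ block p (x i) ↔ (e.symm a : ℕ) ≤ i := by
    intro i hi a
    obtain ⟨j, rfl⟩ := e.surjective a
    rw [Equiv.symm_apply_apply]
    refine ⟨fun h => ?_, fun h => hmono j i h hi (hf j)⟩
    by_contra hlt
    exact hfn j i (by omega) h
  refine ⟨Fin.revPerm.trans e, ?_, fun i hi => Setoid.ext fun a b => ?_⟩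
  · have hp : p ∈ block p (x 0) := (x 0).refl p
    rw [hblock 0 (by omega)] at hp
    rw [Equiv.trans_apply, ← Equiv.eq_symm_apply]
    ext
    simp
    omega
  · have hv : ∀ a, (((Fin.revPerm.trans e)⁻¹ a : Fin n) : ℕ) = n - (e.symm a + 1) := fun a => by
      rw [Equiv.Perm.inv_def, Equiv.symm_trans_apply]
      simp
    rw [split_Icc_iff, eq_iff_of_growing h0 hcov hgrow hi, hblock i hi, hblock i hi, hv, hv]
    have ha := (e.symm a).2
    have hb := (e.symm b).2
    exact or_congr_right (and_congr (by omega) (by omega))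

theorem le_inv_iff_of_split_eq (hn : 2 ≤ n) {ω τ : Equiv.Perm (Fin n)}
    (hlast : ω ⟨n - 1, by omega⟩ = τ ⟨n - 1, by omega⟩) {i : ℕ} {S : Finset ℕ}
    (hS : S ⊆ Finset.Icc 1 (n - 1)) (hi : i ≤ n - 1)
    (h : split ω (Finset.Icc 1 (n - 1 - i)) = split τ S) (a : Fin n) :
    n - 1 - i ≤ (ω⁻¹ a : Fin n) ↔ n - 1 - i ≤ (τ⁻¹ a : Fin n) := by
  -- The block of `ω(n) = τ(n)` is a final segment of `ω`, of length `i + 1`, and one of `τ`.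
  have key : ∀ a, n - 1 - i ≤ (ω⁻¹ a : Fin n) ↔ S.sup id ≤ (τ⁻¹ a : Fin n) := by
    intro a
    have hω : ω⁻¹ (τ ⟨n - 1, by omega⟩) = ⟨n - 1, by omega⟩ := by
      rw [← hlast]; exact Equiv.symm_apply_apply ω _
    have hτ : τ⁻¹ (τ ⟨n - 1, by omega⟩) = ⟨n - 1, by omega⟩ := Equiv.symm_apply_apply τ _
    have h1 : split ω (Finset.Icc 1 (n - 1 - i)) (τ ⟨n - 1, by omega⟩) a ↔
        n - 1 - i ≤ (ω⁻¹ a : Fin n) := by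
      have := (ω⁻¹ a).2
      rw [split_Icc_iff, hω]
      constructor
      · rintro (rfl | h)
        · rw [hω]; simp
        · omega
      · intro h
        exact Or.inr ⟨by simp only; omega, by omega⟩
    rw [← h1, h, Finset.sup_le_iff]
    refine forall₂_congr fun s hs => ?_
    have := Finset.mem_Icc.1 (hS hs)
    rw [hτ]
    simp only [id]
    omega
  have hcard : ∀ (σ : Equiv.Perm (Fin n)) (m : ℕ), m ≤ n - 1 →
      Nat.card {a // m ≤ (σ⁻¹ a : Fin n)} = n - m := by
    intro σ m hm
    have hm' : m < n := by omega
    rw [Nat.card_congr (σ⁻¹.subtypeEquiv (q := fun b : Fin n => b ∈ Finset.Ici ⟨m, hm'⟩)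
      fun a => by rw [Finset.mem_Ici, Fin.le_def])]
    rw [Nat.card_eq_fintype_card, Fintype.card_coe, Fin.card_Ici]
  have hsup : S.sup id ≤ n - 1 := Finset.sup_le fun s hs => (Finset.mem_Icc.1 (hS hs)).2
  have h1 := hcard ω (n - 1 - i) (by omega)
  rw [Nat.card_congr (Equiv.subtypeEquivRight key), hcard τ _ hsup] at h1
  rw [key, show S.sup id = n - 1 - i by omega]

/-- Among the permutations with the same last letter as `τ`, only `τ` itself has its spine in `Π_τ`. -/
theorem eq_of_spine_mem_splittings (hn : 2 ≤ n) {ω τ : Equiv.Perm (Fin n)}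
    (hlast : ω ⟨n - 1, by omega⟩ = τ ⟨n - 1, by omega⟩)
    (h : ∀ i ≤ n - 1, split ω (Finset.Icc 1 (n - 1 - i)) ∈ splittings τ) : ω = τ := by
  have key : ∀ m ≤ n - 1, ∀ a, m ≤ (ω⁻¹ a : Fin n) ↔ m ≤ (τ⁻¹ a : Fin n) := by
    intro m hm a
    obtain ⟨S, hS, hSe⟩ := h (n - 1 - m) (by omega)
    have := le_inv_iff_of_split_eq hn hlast hS (by omega) hSe.symm a
    rwa [show n - 1 - (n - 1 - m) = m by omega] at this
  refine inv_injective (Equiv.ext fun a => Fin.ext (le_antisymm ?_ ?_))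
  · exact (key _ (by omega) a).1 le_rfl
  · exact (key _ (by omega) a).2 le_rfl

/-! ### The fundamental cycle of the splittings of a permutation -/

theorem split_le_split_iff (ω : Equiv.Perm (Fin n)) {S S' : Finset ℕ}
    (hS' : S' ⊆ Finset.Icc 1 (n - 1)) : split ω S ≤ split ω S' ↔ S' ⊆ S := by
  refine ⟨fun h i hi => ?_, fun h a b hab i hi => hab i (h hi)⟩
  by_contra hiS
  have hi' := Finset.mem_Icc.1 (hS' hi)
  have h1 : ω⁻¹ (ω ⟨i - 1, by omega⟩) = ⟨i - 1, by omega⟩ := Equiv.symm_apply_apply ω _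
  have h2 : ω⁻¹ (ω ⟨i, by omega⟩) = ⟨i, by omega⟩ := Equiv.symm_apply_apply ω _
  have := @h (ω ⟨i - 1, by omega⟩) (ω ⟨i, by omega⟩) (fun s hs => by
    have : s ≠ i := fun h => hiS (h ▸ hs)
    rw [h1, h2]
    simp only
    omega) i hi
  rw [h1, h2] at this
  simp only at this
  omega

theorem split_Icc_eq_bot (ω : Equiv.Perm (Fin n)) : split ω (Finset.Icc 1 (n - 1)) = ⊥ := by
  refine eq_bot_iff.2 fun a b hab => ?_
  rcases (split_Icc_iff ω (i := 0) a b).1 hab with h | h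
  · exact h
  · refine ω⁻¹.injective (Fin.ext ?_)
    have := (ω⁻¹ a).2
    have := (ω⁻¹ b).2
    omega

theorem split_empty (ω : Equiv.Perm (Fin n)) : split ω ∅ = ⊤ :=
  eq_top_iff.2 fun _ _ _ i hi => absurd hi (Finset.notMem_empty i)

theorem bot_mem_splittings (ω : Equiv.Perm (Fin n)) : ⊥ ∈ splittings ω :=
  ⟨_, subset_rfl, split_Icc_eq_bot ω⟩

theorem top_mem_splittings (ω : Equiv.Perm (Fin n)) : ⊤ ∈ splittings ω :=
  ⟨∅, Finset.empty_subset _, split_empty ω⟩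

/-- The set `{σ(a) | a > j}` of positions, where `{0, …, k}` stands for the positions
`1, …, k + 1`. -/
def cutSet (σ : Equiv.Perm (Fin (k + 1))) (j : ℕ) : Finset ℕ :=
  {a : Fin (k + 1) | j < a}.toFinset.image fun a => (σ a : ℕ) + 1

theorem mem_cutSet {σ : Equiv.Perm (Fin (k + 1))} {j : ℕ} {b : Fin (k + 1)} :
    (b : ℕ) + 1 ∈ cutSet σ j ↔ j < (σ⁻¹ b : Fin (k + 1)) := by
  simp only [cutSet, Finset.mem_image, Set.mem_toFinset, Set.mem_ofPred_eq, add_left_inj,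
    ← Fin.ext_iff]
  constructor
  · rintro ⟨a, ha, rfl⟩
    rwa [Equiv.Perm.inv_def, Equiv.symm_apply_apply]
  · exact fun h => ⟨_, h, σ.apply_symm_apply b⟩

theorem cutSet_subset (hk : k + 2 = n) (σ : Equiv.Perm (Fin (k + 1))) (j : ℕ) :
    cutSet σ j ⊆ Finset.Icc 1 (n - 1) := by
  intro s hs
  obtain ⟨a, -, rfl⟩ := Finset.mem_image.1 hs
  have := (σ a).2
  exact Finset.mem_Icc.2 ⟨by omega, by omega⟩

theorem cutSet_anti (σ : Equiv.Perm (Fin (k + 1))) {i j : ℕ} (hij : i ≤ j) :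
    cutSet σ j ⊆ cutSet σ i := by
  intro s hs
  obtain ⟨a, ha, rfl⟩ := Finset.mem_image.1 hs
  rw [mem_cutSet, Equiv.Perm.inv_def, Equiv.symm_apply_apply]
  exact hij.trans_lt (by simpa using ha)

theorem cutSet_ext {σ τ : Equiv.Perm (Fin (k + 1))} {i j : ℕ}
    (h : ∀ b, i < (σ⁻¹ b : Fin (k + 1)) ↔ j < (τ⁻¹ b : Fin (k + 1))) :
    cutSet σ i = cutSet τ j := by
  ext s
  constructor <;> intro hs <;> obtain ⟨a, -, rfl⟩ := Finset.mem_image.1 hs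
  · exact mem_cutSet.2 ((h _).1 (mem_cutSet.1 hs))
  · exact mem_cutSet.2 ((h _).2 (mem_cutSet.1 hs))

/-- The maximal chain of the proper part of `Π_ω` that belongs to the order `σ` of the `k + 1`
positions: the positions `σ(k), σ(k-1), …` are cut one after the other on the way down. -/
def cutChain (hk : k + 2 = n) (ω : Equiv.Perm (Fin n)) (σ : Equiv.Perm (Fin (k + 1))) :
    Fin k ↪o ProperPart (splittings ω) :=
  OrderEmbedding.ofStrictMono
    (fun j => ⟨⟨split ω (cutSet σ j), _, cutSet_subset hk σ j, rfl⟩, by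
      have hj := j.2
      constructor
      · intro h
        have h1 := (split_le_split_iff ω subset_rfl).1
          (h ⟨split ω (Finset.Icc 1 (n - 1)), _, subset_rfl, rfl⟩)
        have h2 := h1 (Finset.mem_Icc.2 ⟨Nat.le_add_left 1 (σ 0), by have := (σ 0).2; omega⟩)
        rw [mem_cutSet, Equiv.Perm.inv_def, Equiv.symm_apply_apply] at h2
        exact absurd h2 (Nat.not_lt_zero _)
      · intro h
        have h1 := (split_le_split_iff ω (cutSet_subset hk σ j)).1
          (h ⟨split ω ∅, _, Finset.empty_subset _, rfl⟩)
        refine Finset.notMem_empty _ (h1 (mem_cutSet (b := σ (Fin.last k)).2 ?_))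
        rw [Equiv.Perm.inv_def, Equiv.symm_apply_apply]
        simp⟩)
    fun i j hij => by
      refine lt_of_le_not_ge ((split_le_split_iff ω (cutSet_subset hk σ j)).2
        (cutSet_anti σ (Fin.le_def.1 hij.le))) fun h => ?_
      have h1 := (split_le_split_iff ω (cutSet_subset hk σ i)).1 h
      have hj := j.2
      have h2 := h1 (mem_cutSet (b := σ ⟨j, by omega⟩).2 (by
        rw [Equiv.Perm.inv_def, Equiv.symm_apply_apply]
        exact hij))
      rw [mem_cutSet, Equiv.Perm.inv_def, Equiv.symm_apply_apply] at h2
      exact lt_irrefl _ h2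

@[simp] theorem cutChain_apply (hk : k + 2 = n) (ω : Equiv.Perm (Fin n))
    (σ : Equiv.Perm (Fin (k + 1))) (j : Fin k) :
    (cutChain hk ω σ j).1.1 = split ω (cutSet σ j) := rfl

theorem cutChain_injective (hk : k + 2 = n) (ω : Equiv.Perm (Fin n)) :
    Function.Injective (cutChain hk ω) := by
  intro σ τ h
  have hset : ∀ j < k, cutSet σ j = cutSet τ j := by
    intro j hj
    have : split ω (cutSet σ j) = split ω (cutSet τ j) :=
      congrArg (fun c : Fin k ↪o ProperPart (splittings ω) => (c ⟨j, hj⟩).1.1) h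
    exact ((split_le_split_iff ω (cutSet_subset hk σ j)).1 this.ge).antisymm
      ((split_le_split_iff ω (cutSet_subset hk τ j)).1 this.le)
  have key : ∀ j < k, ∀ b, j < (σ⁻¹ b : Fin (k + 1)) ↔ j < (τ⁻¹ b : Fin (k + 1)) := by
    intro j hj b
    rw [← mem_cutSet, ← mem_cutSet, hset j hj]
  refine inv_injective (Equiv.ext fun b => Fin.ext ?_)
  have h1 := (σ⁻¹ b).2
  have h2 := (τ⁻¹ b).2
  rcases lt_trichotomy ((σ⁻¹ b : Fin (k + 1)) : ℕ) (τ⁻¹ b : Fin (k + 1)) with h | h | h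
  · have := key (σ⁻¹ b : Fin (k + 1)) (by omega) b
    omega
  · exact h
  · have := key (τ⁻¹ b : Fin (k + 1)) (by omega) b
    omega

theorem face_cutChain_swap (hk : k + 3 = n) (ω : Equiv.Perm (Fin n))
    (σ : Equiv.Perm (Fin (k + 2))) (i : Fin (k + 1)) :
    face (cutChain hk ω (σ * Equiv.swap i.castSucc i.succ)) i = face (cutChain hk ω σ) i := by
  refine RelEmbedding.ext fun x => Subtype.ext (Subtype.ext ?_)
  change split ω (cutSet _ (i.succAbove x)) = split ω (cutSet _ (i.succAbove x))
  have hx : ((i.succAbove x : Fin (k + 1)) : ℕ) ≠ i :=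
    fun h => Fin.succAbove_ne i x (Fin.ext h)
  congr 1
  refine cutSet_ext fun b => ?_
  rw [mul_inv_rev, Equiv.swap_inv, Equiv.Perm.mul_apply]
  generalize σ⁻¹ b = a
  rcases eq_or_ne a i.castSucc with rfl | h1
  · rw [Equiv.swap_apply_left]
    simp
    omega
  · rcases eq_or_ne a i.succ with rfl | h2
    · rw [Equiv.swap_apply_right]
      simp
      omega
    · rw [Equiv.swap_apply_of_ne_of_ne h1 h2]

/-- The alternating sum of the maximal chains of the proper part of `Π_ω`, which is the order
complex of a Boolean lattice. -/
noncomputable def sphereCycle (hk : k + 2 = n) (ω : Equiv.Perm (Fin n)) :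
    Chains (ProperPart (splittings ω)) k :=
  ∑ σ : Equiv.Perm (Fin (k + 1)), Finsupp.single (cutChain hk ω σ) (Equiv.Perm.sign σ : ℤ)

theorem sphereCycle_mem_cycles (hk : k + 2 = n) (ω : Equiv.Perm (Fin n)) :
    sphereCycle hk ω ∈ cycles (ProperPart (splittings ω)) k := by
  cases k with
  | zero => exact Submodule.mem_top
  | succ k =>
    change boundary _ k (sphereCycle hk ω) = 0
    simp only [sphereCycle, boundary, map_sum, Finsupp.linearCombination_single, Finset.smul_sum]
    rw [Finset.sum_comm]
    refine Finset.sum_eq_zero fun i _ => ?_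
    refine Finset.sum_involution (fun σ _ => σ * Equiv.swap i.castSucc i.succ) ?_ ?_ ?_ ?_
    · intro σ _
      have hne : i.castSucc ≠ i.succ := (Fin.castSucc_lt_succ).ne
      rw [face_cutChain_swap, Equiv.Perm.sign_mul, Equiv.Perm.sign_swap hne]
      simp
    · intro σ _ _ h
      have hne : i.castSucc ≠ i.succ := (Fin.castSucc_lt_succ).ne
      exact hne (Equiv.swap_eq_one_iff.1 (mul_eq_left.1 h))
    · exact fun _ _ => Finset.mem_univ _
    · intro σ _
      simp [mul_assoc]

theorem sphereCycle_apply (hk : k + 2 = n) (ω : Equiv.Perm (Fin n))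
    (σ : Equiv.Perm (Fin (k + 1))) :
    sphereCycle hk ω (cutChain hk ω σ) = (Equiv.Perm.sign σ : ℤ) := by
  classical
  simp [sphereCycle, Finsupp.finsetSum_apply, Finsupp.single_apply,
    (cutChain_injective hk ω).eq_iff]

/-! ### Coefficients at the spines -/

/-- A top-dimensional cycle is determined by its coefficients at the chains that are spines of
permutations with last letter `p`. -/
theorem cycle_eq_zero_of_spines (hk : k + 2 = n) (p : Fin n)
    {z : Chains (ProperPart A) k} (hz : z ∈ cycles (ProperPart A) k)
    (h : ∀ (c : Fin k ↪o ProperPart A) (ω : Equiv.Perm (Fin n)), ω ⟨n - 1, by omega⟩ = p →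
      (∀ i ≤ n - 1, extend c i = split ω (Finset.Icc 1 (n - 1 - i))) → z c = 0) : z = 0 := by
  refine cycle_eq_zero_of_growing hk p hz fun c hc => ?_
  obtain ⟨ω, h1, h2⟩ := exists_perm_of_growing (by omega) (extend_zero c)
    (fun i hi => extend_covBy hk c (by omega)) fun i hi => hc i (by omega)
  exact h c ω h1 h2

/-- The maximal chain of the proper part of `Π_ω` whose `j`-th element has the `j + 2` last letters
of `ω` in one block and all other blocks singletons. -/
def spine (hk : k + 2 = n) (ω : Equiv.Perm (Fin n)) : Fin k ↪o ProperPart (splittings ω) :=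
  cutChain hk ω Fin.revPerm

theorem spine_apply (hk : k + 2 = n) (ω : Equiv.Perm (Fin n)) (j : Fin k) :
    (spine hk ω j).1.1 = split ω (Finset.Icc 1 (n - 1 - (j + 1))) := by
  have hj := j.2
  rw [spine, cutChain_apply]
  congr 1
  refine Finset.Subset.antisymm (fun s hs => ?_) fun s hs => ?_
  · obtain ⟨a, ha, rfl⟩ := Finset.mem_image.1 hs
    have ha : (j : ℕ) < a := by simpa using ha
    have := a.2
    rw [Finset.mem_Icc, Fin.revPerm_apply, Fin.val_rev]
    omega
  · rw [Finset.mem_Icc] at hs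
    obtain ⟨s, rfl⟩ : ∃ t, s = t + 1 := ⟨s - 1, by omega⟩
    refine (mem_cutSet (b := ⟨s, by omega⟩)).2 ?_
    rw [Equiv.Perm.inv_def, Fin.revPerm_symm, Fin.revPerm_apply, Fin.val_rev]
    simp only
    omega

theorem eq_of_extend_eq_split (hk : k + 2 = n) {c : Fin k ↪o ProperPart A}
    {ω τ : Equiv.Perm (Fin n)} (hA : ∀ i ≤ n - 1, extend c i ∈ splittings τ)
    (hlast : ω ⟨n - 1, by omega⟩ = τ ⟨n - 1, by omega⟩)
    (hc : ∀ i ≤ n - 1, extend c i = split ω (Finset.Icc 1 (n - 1 - i))) : ω = τ :=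
  eq_of_spine_mem_splittings (by omega) hlast fun i hi => hc i hi ▸ hA i hi

theorem isUnit_sphereCycle_spine (hk : k + 2 = n) (ω : Equiv.Perm (Fin n)) :
    IsUnit (sphereCycle hk ω (spine hk ω)) := by
  rw [spine, sphereCycle_apply]
  exact Units.isUnit _

theorem cycle_splittings_eq_zero (hk : k + 2 = n) (ω : Equiv.Perm (Fin n))
    {z : Chains (ProperPart (splittings ω)) k} (hz : z ∈ cycles (ProperPart (splittings ω)) k)
    (h : z (spine hk ω) = 0) : z = 0 := by
  refine cycle_eq_zero_of_spines hk (ω ⟨n - 1, by omega⟩) hz fun c τ hτ hc => ?_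
  obtain rfl := eq_of_extend_eq_split hk
    (fun i _ => extend_mem (bot_mem_splittings ω) (top_mem_splittings ω) c i) hτ hc
  convert h using 2
  refine RelEmbedding.ext fun j => Subtype.ext (Subtype.ext ?_)
  rw [← extend_fin_succ, spine_apply, hc _ (by omega)]

/-- The coefficient at the spine identifies `H̃_{n-3}` of the proper part of `Π_ω` with `ℤ`. -/
theorem exists_homologyEquiv (hk : k + 2 = n) (ω : Equiv.Perm (Fin n)) :
    haveI := isEmpty_chains hk (A := splittings ω)
    ∃ e : ReducedHomology (ProperPart (splittings ω)) k ≃ₗ[ℤ] ℤ,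
      ∀ x, e x = (homologyEquivCycles _ k x).1 (spine hk ω) := by
  have := isEmpty_chains hk (A := splittings ω)
  let φ : cycles (ProperPart (splittings ω)) k →ₗ[ℤ] ℤ :=
    Finsupp.lapply (spine hk ω) ∘ₗ Submodule.subtype _
  have hφ : Function.Bijective φ := by
    constructor
    · rw [injective_iff_map_eq_zero]
      exact fun z hz => Subtype.ext (cycle_splittings_eq_zero hk ω z.2 hz)
    · intro a
      -- The unit coefficient of the alternating sum makes `φ` surjective.
      obtain ⟨u, hu⟩ := isUnit_sphereCycle_spine hk ω
      refine ⟨(a * ↑u⁻¹ : ℤ) • ⟨_, sphereCycle_mem_cycles hk ω⟩, ?_⟩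
      change (a * ↑u⁻¹ : ℤ) • sphereCycle hk ω (spine hk ω) = a
      rw [← hu, smul_eq_mul, mul_assoc, Units.inv_mul, mul_one]
  exact ⟨(homologyEquivCycles _ k).trans (LinearEquiv.ofBijective φ hφ), fun _ => rfl⟩

/-- A fundamental cycle of `Π_ω` has coefficient `±1` at the spine of `ω`. -/
theorem isUnit_fundamentalCycle_spine (hk : k + 2 = n) {ω : Equiv.Perm (Fin n)}
    {x : ReducedHomology (ProperPart (splittings ω)) k} (hx : IsFundamentalCycle x) :
    haveI := isEmpty_chains hk (A := splittings ω)
    IsUnit ((homologyEquivCycles _ k x).1 (spine hk ω)) := by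
  obtain ⟨e, he⟩ := exists_homologyEquiv hk ω
  obtain ⟨e', he'⟩ := hx
  rw [← he]
  refine IsUnit.of_mul_eq_one (e' (e.symm 1)) ?_
  rw [← smul_eq_mul, ← map_smul, ← map_smul, smul_eq_mul, mul_one, e.symm_apply_apply, he']

/-! ### The restricted partition posets -/

theorem top_mem_restricted (hn : 2 ≤ n) {T : Set (Fin n)} (hT : T.Nonempty) :
    ⊤ ∈ restricted hn T :=
  Or.inr ⟨hT.some, hT.some_mem, trivial⟩

theorem bot_mem_restricted (hn : 2 ≤ n) (T : Set (Fin n)) : ⊥ ∈ restricted hn T :=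
  Or.inl fun _ h => Eq.symm h

/-- The atom of the spine of `ω` has the only nontrivial block `{ω(n-1), n}`, so it lies in `Π_n(T)`
only if `ω(n-1) ∈ T`. For `n = 2` the partition in question is `⊤` instead of an atom. -/
theorem mem_basisPerms (hn : 2 ≤ n) {T : Set (Fin n)} (hTn : ∀ t ∈ T, t ≠ ⟨n - 1, by omega⟩)
    {ω : Equiv.Perm (Fin n)} (hω : ω ⟨n - 1, by omega⟩ = ⟨n - 1, by omega⟩)
    (h : split ω (Finset.Icc 1 (n - 1 - 1)) ∈ restricted hn T) : ω ∈ basisPerms hn T := by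
  have h1 : ω⁻¹ ⟨n - 1, by omega⟩ = ⟨n - 1, by omega⟩ := by rw [Equiv.Perm.inv_eq_iff_eq, hω]
  have h2 : ω⁻¹ (ω ⟨n - 2, by omega⟩) = ⟨n - 2, by omega⟩ := Equiv.symm_apply_apply ω _
  refine ⟨hω, ?_⟩
  rcases h with h | ⟨t, ht, hrel⟩
  · have h3 := h (ω ⟨n - 2, by omega⟩) ((split_Icc_iff ω _ _).2 (Or.inr (by
      rw [h1, h2]
      simp only
      omega)))
    have h4 := congrArg Fin.val (ω.injective (h3.trans hω.symm))
    simp only at h4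
    omega
  · rcases (split_Icc_iff ω _ _).1 hrel with h3 | h3
    · exact absurd h3.symm (hTn t ht)
    · have h4 : ω⁻¹ t ≠ ⟨n - 1, by omega⟩ := fun h4 => hTn t ht (by
        rw [← h1] at h4
        exact ω⁻¹.injective h4)
      have h5 : ω⁻¹ t = ⟨n - 2, by omega⟩ := by
        have h6 := Fin.val_ne_of_ne h4
        have := (ω⁻¹ t).2
        refine Fin.ext ?_
        simp only at h6 ⊢
        omega
      rw [Equiv.Perm.inv_eq_iff_eq] at h5
      exact h5 ▸ ht

/-- The spine of `ω`, as a chain of the proper part of `Π_n(T)`. -/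
def restrictedSpine (hn : 2 ≤ n) (hk : k + 2 = n) (T : Set (Fin n)) (ω : basisPerms hn T) :
    Fin k ↪o ProperPart (restricted hn T) :=
  (spine hk ω.1).trans (ProperPart.inclusion (splittings_subset_restricted hn T ω.1 ω.2))

theorem extend_restrictedSpine (hn : 2 ≤ n) (hk : k + 2 = n) (T : Set (Fin n))
    (ω : basisPerms hn T) (i : ℕ) :
    extend (restrictedSpine hn hk T ω) i = extend (spine hk ω.1) i := by
  cases i <;> rfl

theorem extend_spine (hk : k + 2 = n) (ω : Equiv.Perm (Fin n)) {i : ℕ} (hi : i ≤ n - 1) :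
    extend (spine hk ω) i = split ω (Finset.Icc 1 (n - 1 - i)) := by
  rcases i with _ | i
  · exact (split_Icc_eq_bot ω).symm
  · rcases (show i ≤ k by omega).eq_or_lt with rfl | hik
    · rw [extend_top, show n - 1 - (i + 1) = 0 by omega]
      exact (split_empty ω).symm
    · rw [extend_fin_succ _ ⟨i, hik⟩, spine_apply]

/-- The cycles of `Π_τ` do not involve the spines of the other permutations. -/
theorem mapChains_restrictedSpine_eq_zero (hn : 2 ≤ n) (hk : k + 2 = n) {T : Set (Fin n)}
    {ω τ : basisPerms hn T} (hne : ω ≠ τ) (z : Chains (ProperPart (splittings τ.1)) k) :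
    mapChains (ProperPart.inclusion (splittings_subset_restricted hn T τ.1 τ.2)) k z
      (restrictedSpine hn hk T ω) = 0 := by
  by_contra h
  obtain ⟨c, hc⟩ := exists_eq_trans_of_mapChains_ne_zero _ z _ h
  refine hne (Subtype.ext (eq_of_extend_eq_split hk (c := spine hk ω.1) (fun i _ => ?_)
    (ω.2.1.trans τ.2.1.symm) fun i hi => extend_spine hk ω.1 hi))
  have h1 : extend (spine hk ω.1) i = extend c i := by
    rw [← extend_restrictedSpine, ← hc]
    cases i <;> rfl
  exact h1 ▸ extend_mem (bot_mem_splittings _) (top_mem_splittings _) c i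

/-- A top-dimensional cycle of `Π_n(T)` is determined by its coefficients at the spines. -/
theorem cycle_restricted_eq_zero (hn : 2 ≤ n) (hk : k + 2 = n) {T : Set (Fin n)}
    (hT : T.Nonempty) (hTn : ∀ t ∈ T, t ≠ ⟨n - 1, by omega⟩)
    {z : Chains (ProperPart (restricted hn T)) k}
    (hz : z ∈ cycles (ProperPart (restricted hn T)) k)
    (h : ∀ ω, z (restrictedSpine hn hk T ω) = 0) : z = 0 := by
  refine cycle_eq_zero_of_spines hk ⟨n - 1, by omega⟩ hz fun c ω hω hc => ?_
  have hmem := extend_mem (bot_mem_restricted hn T) (top_mem_restricted hn hT) c 1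
  rw [hc 1 (by omega)] at hmem
  convert h ⟨ω, mem_basisPerms hn hTn hω hmem⟩ using 2
  refine RelEmbedding.ext fun j => Subtype.ext (Subtype.ext ?_)
  rw [← extend_fin_succ, hc _ (by omega)]
  exact (spine_apply hk ω j).symm

theorem exists_basis (hn : 2 ≤ n) (hk : k + 2 = n) {T : Set (Fin n)}
    (hT : T.Nonempty) (hTn : ∀ t ∈ T, t ≠ ⟨n - 1, by omega⟩)
    (ρ : (ω : Equiv.Perm (Fin n)) → ReducedHomology (ProperPart (splittings ω)) k)
    (hρ : ∀ ω, IsFundamentalCycle (ρ ω)) :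
    ∃ b : Module.Basis (basisPerms hn T) ℤ (ReducedHomology (ProperPart (restricted hn T)) k),
      ∀ ω : basisPerms hn T, b ω = mapHomology
        (ProperPart.inclusion (splittings_subset_restricted hn T ω.1 ω.2)) k (ρ ω.1) := by
  classical
  have := fun ω : Equiv.Perm (Fin n) => isEmpty_chains hk (A := splittings ω)
  have := isEmpty_chains hk (A := restricted hn T)
  let r : basisPerms hn T → ReducedHomology (ProperPart (restricted hn T)) k := fun ω =>
    mapHomology (ProperPart.inclusion (splittings_subset_restricted hn T ω.1 ω.2)) k (ρ ω.1)
  let Φ : ReducedHomology (ProperPart (restricted hn T)) k →ₗ[ℤ] basisPerms hn T → ℤ :=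
    LinearMap.pi fun ω => Finsupp.lapply (restrictedSpine hn hk T ω) ∘ₗ
      Submodule.subtype _ ∘ₗ (homologyEquivCycles _ k).toLinearMap
  have hΦ : Function.Injective Φ := by
    rw [injective_iff_map_eq_zero]
    intro x hx
    refine (homologyEquivCycles _ k).map_eq_zero_iff.1 (Subtype.ext ?_)
    exact cycle_restricted_eq_zero hn hk hT hTn (homologyEquivCycles _ k x).2 (congrFun hx)
  have hΦr : ∀ τ, ∃ u : ℤˣ, Φ (r τ) = Pi.single τ (u : ℤ) := by
    intro τ
    obtain ⟨u, hu⟩ := isUnit_fundamentalCycle_spine hk (hρ τ.1)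
    refine ⟨u, funext fun ω => ?_⟩
    change (homologyEquivCycles _ k (r τ)).1 (restrictedSpine hn hk T ω) = _
    rw [homologyEquivCycles_mapHomology]
    change mapChains _ k (homologyEquivCycles _ k (ρ τ.1)).1 _ = _
    by_cases h : ω = τ
    · subst h
      rw [Pi.single_eq_same, hu]
      exact mapChains_apply_trans _ _ _
    · rw [Pi.single_eq_of_ne h]
      exact mapChains_restrictedSpine_eq_zero hn hk h _
  choose u hu using hΦr
  have hli : LinearIndependent ℤ r := by
    rw [Fintype.linearIndependent_iff]
    intro g hg τ
    have := congrFun (congrArg Φ hg) τ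
    simpa [map_sum, hu, Finset.sum_apply, Pi.single_apply] using this
  have hsp : ⊤ ≤ Submodule.span ℤ (Set.range r) := by
    intro x _
    have hx : x = ∑ ω, (Φ x ω * ((u ω)⁻¹ : ℤˣ)) • r ω := by
      refine hΦ (funext fun τ => ?_)
      simp [map_sum, hu, Finset.sum_apply, Pi.single_apply, mul_assoc]
    rw [hx]
    exact Submodule.sum_mem _ fun ω _ =>
      Submodule.smul_mem _ _ (Submodule.subset_span (Set.mem_range_self ω))
  exact ⟨Module.Basis.mk hli hsp, fun ω => Module.Basis.mk_apply hli hsp ω⟩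

end PartitionLattice

theorem theorem9p3 (n : ℕ) (hn : 2 ≤ n) (T : Set (Fin n)) (hT : T.Nonempty)
    (hTn : ∀ t ∈ T, t ≠ ⟨n - 1, by omega⟩) :
    (∀ ω : Equiv.Perm (Fin n),
      ∃ z : OrderComplex.ReducedHomology (ProperPart (PartitionLattice.splittings ω)) (n - 2),
        OrderComplex.IsFundamentalCycle z) ∧
    ∀ ρ : (ω : Equiv.Perm (Fin n)) →
        OrderComplex.ReducedHomology (ProperPart (PartitionLattice.splittings ω)) (n - 2),
      (∀ ω, OrderComplex.IsFundamentalCycle (ρ ω)) →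
      ∃ b : Module.Basis (PartitionLattice.basisPerms hn T) ℤ
          (OrderComplex.ReducedHomology (ProperPart (PartitionLattice.restricted hn T)) (n - 2)),
        ∀ ω : PartitionLattice.basisPerms hn T,
          b ω = OrderComplex.mapHomology
            (ProperPart.inclusion
              (PartitionLattice.splittings_subset_restricted hn T ω.1 ω.2)) (n - 2) (ρ ω.1) := by
  have hk : n - 2 + 2 = n := by omega
  refine ⟨fun ω => ?_, fun ρ hρ => PartitionLattice.exists_basis hn hk hT hTn ρ hρ⟩
  obtain ⟨e, -⟩ := PartitionLattice.exists_homologyEquiv hk ω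
  exact ⟨e.symm 1, e, e.apply_symm_apply 1⟩
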